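/- Let $G$ be a finite connected metric tree with at least one edge: a finite connected graph without cycles (in particular without loops and parallel edges), with vertex set $V$ and edge set $E \neq \emptyset$, in which every edge $e$ has a length $L(e) \in (0,\infty)$, runs from a vertex $o(e)$ to a vertex $t(e)$, and is identified with the interval $[0, L(e)]$. Let $L_{\max} = \max_{e \in E} L(e)$. Let $\lambda_1(G) \le \lambda_2(G) \le \dots$ be the eigenvalues, counted with multiplicities, of the standard Laplacian $-\Delta_G$ in $L^2(G) = \bigoplus_{e \in E} L^2(0, L(e))$ (complex-valued functions), which acts as $(-\Delta_G f)_e = -f_e''$ on the functions $f \in \bigoplus_{e \in E} H^2(0, L(e))$ that are continuous on $G$ (at every vertex $v$ the boundary values at $v$ of all $f_e$ with $e$ incident to $v$ coincide) and satisfy $$\sum_{t(e) = v} f_e'(L(e)) - \sum_{o(e) = v} f_e'(0) = 0 \quad \text{for all } v \in V.$$ Then $$\lambda_{k+1}(G) \le \frac{k^2 \pi^2}{L_{\max}^2} \quad \text{for all integers } k \ge 1.$$ If, moreover, $G$ contains two edges whose lengths are linearly independent over $\mathbb{Q}$, then this inequality is strict for all integers $k \ge 1$. -/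

import Mathlib

open MeasureTheory
open scoped ContDiff ENNReal

noncomputable section

/-- A finite metric graph (when `V` and `E` are finite): vertices `V`, edges `E`, every edge `e`
runs from `o e` to `t e` and is identified with the interval `[0, len e]`, `len e > 0`.
Loops and parallel edges are allowed. -/
structure MetricGraph (V E : Type*) where
  /-- the vertex from which an edge originates -/
  o : E → V
  /-- the vertex at which an edge terminates -/
  t : E → V
  /-- the length of an edge -/
  len : E → ℝ
  len_pos : ∀ e, 0 < len e

/-- The space `L²(0, ℓ)` of complex-valued functions. -/
abbrev EdgeL2 (ℓ : ℝ) : Type := Lp ℂ 2 (volume.restrict (Set.Ioo (0 : ℝ) ℓ))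

/-- `g` is the weak derivative of `f` on the interval `(0, ℓ)`. -/
def HasWeakDeriv (ℓ : ℝ) (f g : ℝ → ℂ) : Prop :=
  ∀ φ : ℝ → ℝ, ContDiff ℝ ∞ φ → HasCompactSupport φ → tsupport φ ⊆ Set.Ioo 0 ℓ →
    ∫ x in Set.Ioo 0 ℓ, ((deriv φ x : ℝ) : ℂ) * f x =
      -∫ x in Set.Ioo 0 ℓ, ((φ x : ℝ) : ℂ) * g x

/-- `f` has a continuous representative on `[0, ℓ]`, whose values at `0` and `ℓ` are `a` and `b`.
(Every `f ∈ H¹(0, ℓ)` has exactly one continuous representative.) -/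
def HasEndpointValues (ℓ : ℝ) (f : ℝ → ℂ) (a b : ℂ) : Prop :=
  ∃ u : ℝ → ℂ, ContinuousOn u (Set.Icc 0 ℓ) ∧
    f =ᵐ[volume.restrict (Set.Ioo 0 ℓ)] u ∧ u 0 = a ∧ u ℓ = b

namespace MetricGraph

variable {V E : Type*}

/-- The underlying simple graph: two distinct vertices are adjacent if some edge joins them. -/
def toSimpleGraph (G : MetricGraph V E) : SimpleGraph V :=
  SimpleGraph.fromEdgeSet (Set.range fun e => s(G.o e, G.t e))

/-- A metric graph is a tree if it is connected and has no cycles: there are no loops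
(cycles with one edge), no parallel edges (cycles with two edges), and the underlying simple graph
is a tree, that is, connected and without cycles. -/
structure IsTree (G : MetricGraph V E) : Prop where
  no_loops : ∀ e, G.o e ≠ G.t e
  no_parallel_edges : Function.Injective fun e => s(G.o e, G.t e)
  isTree : G.toSimpleGraph.IsTree

/-- The length of the longest edge. -/
def maxLength [Fintype E] [Nonempty E] (G : MetricGraph V E) : ℝ :=
  Finset.univ.sup' Finset.univ_nonempty G.len

/-- The Hilbert space `L²(G) = ⨁ₑ L²(0, len e)`. -/
abbrev L2 (G : MetricGraph V E) : Type _ := PiLp 2 fun e : E => EdgeL2 (G.len e)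

open Classical in
/-- The graph of the standard Laplacian: `G.StandardLaplacian f h` says that `f` lies in the domain
of `-Δ_G` and `-Δ_G f = h`. Here `f'` is the edgewise weak derivative of `f`, whose weak derivative
is `-h`; thus `f` is edgewise in `H²`. The function `f` is continuous on `G`, `c v` being its value
at the vertex `v`. With `a e = f_e'(0)` and `b e = f_e'(len e)`, the Kirchhoff condition
`∂_ν f (v) = ∑_{t e = v} f_e'(len e) - ∑_{o e = v} f_e'(0) = 0` holds at every vertex. -/
def StandardLaplacian [Fintype E] (G : MetricGraph V E) (f h : G.L2) : Prop :=
  ∃ f' : G.L2,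
    (∀ e, HasWeakDeriv (G.len e) (f e) (f' e)) ∧
    (∀ e, HasWeakDeriv (G.len e) (f' e) ((-h) e)) ∧
    (∃ c : V → ℂ, ∀ e, HasEndpointValues (G.len e) (f e) (c (G.o e)) (c (G.t e))) ∧
    ∃ a b : E → ℂ, (∀ e, HasEndpointValues (G.len e) (f' e) (a e) (b e)) ∧
      ∀ v, (∑ e with G.t e = v, b e) - (∑ e with G.o e = v, a e) = 0

/-- The linear span of all `f ∈ ker(-Δ_G - ν)` with `ν ≤ μ`. Its dimension is the number of
eigenvalues `≤ μ` of `-Δ_G`, counted with multiplicities. -/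
def spectralSpan [Fintype E] (G : MetricGraph V E) (μ : ℝ) : Submodule ℂ G.L2 :=
  Submodule.span ℂ {f | ∃ ν : ℝ, ν ≤ μ ∧ G.StandardLaplacian f ((ν : ℂ) • f)}

/-- `G.eigenvalue k`, for `k ≥ 1`, is the `k`-th eigenvalue of `-Δ_G` in nondecreasing order,
counted with multiplicities: the least `μ` such that at least `k` eigenvalues are `≤ μ`.
It would be `⊤` if there were fewer than `k` eigenvalues, so a finite upper bound
also asserts that the eigenvalue exists. -/
def eigenvalue [Fintype E] (G : MetricGraph V E) (k : ℕ) : EReal :=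
  ⨅ (μ : ℝ) (_ : (k : Cardinal) ≤ Module.rank ℂ (G.spectralSpan μ)), (μ : EReal)

end MetricGraph

end

noncomputable section

section MinMax

open Module.End

variable {H : Type*} [NormedAddCommGroup H] [InnerProductSpace ℂ H]

open scoped ComplexOrder in
/-- The norm of a compact positive operator is an eigenvalue. -/
theorem exists_eigenvector_norm_of_isPositive [CompleteSpace H] [Nontrivial H] {R : H →L[ℂ] H}
    (hc : IsCompactOperator R) (hp : R.IsPositive) (h0 : R ≠ 0) :
    ∃ x : H, x ≠ 0 ∧ R x = ((‖R‖ : ℝ) : ℂ) • x := by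
  have hsa : IsSelfAdjoint R := hp.isSelfAdjoint
  obtain ⟨z, hz, hzn⟩ := spectrum.exists_nnnorm_eq_spectralRadius R
  rw [show spectralRadius ℂ R = _ from R.spectralRadius_eq_nnnorm hsa] at hzn
  have hzn' : ‖z‖ = ‖R‖ := by
    have := ENNReal.coe_inj.1 hzn
    simpa using congrArg NNReal.toReal this
  have hz0 : z ≠ 0 := by
    rintro rfl
    apply h0
    simpa using hzn'.symm
  have hev := (hc.hasEigenvalue_iff_mem_spectrum hz0).2 hz
  obtain ⟨x, hx⟩ := hev.exists_hasEigenvector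
  have hRx : R x = z • x := hx.apply_eq_smul
  have hx0 : x ≠ 0 := hx.2
  refine ⟨x, hx0, ?_⟩
  have hin := hp.inner_nonneg_right x
  rw [hRx, inner_smul_right, inner_self_eq_norm_sq_to_K] at hin
  have hxn : (0 : ℂ) < ((‖x‖ : ℝ) : ℂ) ^ 2 := by
    have : (0:ℝ) < ‖x‖ ^ 2 := by positivity
    exact_mod_cast this
  have hz_nonneg : 0 ≤ z := by
    have hne : (((‖x‖ : ℝ) : ℂ) ^ 2) ≠ 0 := hxn.ne'
    have h2 : (0 : ℂ) ≤ (((‖x‖ ^ 2)⁻¹ : ℝ) : ℂ) := Complex.zero_le_real.2 (by positivity)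
    have h3 := mul_nonneg hin h2
    rwa [Complex.ofReal_inv, Complex.ofReal_pow, RCLike.ofReal_eq_complex_ofReal,
      mul_assoc, mul_inv_cancel₀ hne, mul_one] at h3
  rw [hRx, ← hzn']
  congr 1
  exact Complex.eq_coe_norm_of_nonneg hz_nonneg

/-- The span of all eigenvectors of `A` with real eigenvalues at least `c`. -/
def upperEigenspan (A : H →L[ℂ] H) (c : ℝ) : Submodule ℂ H :=
  ⨆ τ : {τ : ℝ // c ≤ τ}, eigenspace (A : Module.End ℂ H) ((τ : ℝ) : ℂ)

theorem mem_upperEigenspan {A : H →L[ℂ] H} {c τ : ℝ} (hτ : c ≤ τ) {x : H}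
    (hx : A x = (τ : ℂ) • x) : x ∈ upperEigenspan A c :=
  Submodule.mem_iSup_of_mem (⟨τ, hτ⟩ : {τ : ℝ // c ≤ τ}) (mem_eigenspace_iff.2 hx)

theorem upperEigenspan_invariant (A : H →L[ℂ] H) (c : ℝ) {x : H}
    (hx : x ∈ upperEigenspan A c) : A x ∈ upperEigenspan A c := by
  induction hx using Submodule.iSup_induction' with
  | mem τ x hx =>
    have : A x = ((τ : ℝ) : ℂ) • x := mem_eigenspace_iff.1 hx
    rw [this]
    exact Submodule.smul_mem _ _ (mem_upperEigenspan τ.2 this)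
  | zero => simp
  | add x y _ _ hx hy => rw [map_add]; exact add_mem hx hy

theorem inner_lt_of_mem_orthogonal_upperEigenspan [CompleteSpace H] {A : H →L[ℂ] H}
    (hc : IsCompactOperator A) (hp : A.IsPositive) {c : ℝ} (hc0 : 0 < c) {x : H}
    (hx : x ∈ (upperEigenspan A c)ᗮ) (hx0 : x ≠ 0) :
    RCLike.re (inner ℂ x (A x)) < c * ‖x‖ ^ 2 := by
  set S := upperEigenspan A c with hS
  have hinv : ∀ y ∈ Sᗮ, A y ∈ Sᗮ := by
    intro y hy
    rw [Submodule.mem_orthogonal] at hy ⊢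
    intro u hu
    have := hp.isSymmetric u y
    simp only [ContinuousLinearMap.coe_coe] at this
    rw [← this]
    exact hy _ (upperEigenspan_invariant A c hu)
  let R : Sᗮ →L[ℂ] Sᗮ := A.restrict hinv
  have hRc : IsCompactOperator R := hc.restrict' hinv
  have hRp : R.IsPositive := by
    rw [ContinuousLinearMap.isPositive_iff]
    constructor
    · intro u v
      exact hp.isSymmetric u v
    · intro u
      exact hp.inner_nonneg_left (u : H)
  have hnt : Nontrivial Sᗮ := ⟨⟨⟨x, hx⟩, 0, fun h => hx0 (congrArg Subtype.val h)⟩⟩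
  have hRn : ‖R‖ < c := by
    by_contra! hcn
    have hR0 : R ≠ 0 := by
      intro h
      have hn : ‖R‖ = 0 := by rw [h]; exact ContinuousLinearMap.opNorm_zero
      linarith
    obtain ⟨y, hy0, hy⟩ := exists_eigenvector_norm_of_isPositive hRc hRp hR0
    have hy' : A (y : H) = ((‖R‖ : ℝ) : ℂ) • (y : H) := congrArg Subtype.val hy
    have h1 := mem_upperEigenspan hcn hy'
    have h2 := (Submodule.mem_orthogonal _ _).1 y.2 _ h1
    exact hy0 (Subtype.ext (inner_self_eq_zero.1 h2))
  have h1 : RCLike.re (inner ℂ x (A x)) ≤ ‖x‖ * ‖R ⟨x, hx⟩‖ :=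
    (RCLike.re_le_norm _).trans (norm_inner_le_norm (𝕜 := ℂ) x (A x))
  have h2 : ‖R ⟨x, hx⟩‖ ≤ ‖R‖ * ‖x‖ := R.le_opNorm _
  have h3 : 0 < ‖x‖ := norm_pos_iff.2 hx0
  calc _ ≤ ‖x‖ * (‖R‖ * ‖x‖) := h1.trans (by gcongr)
    _ = ‖R‖ * ‖x‖ ^ 2 := by ring
    _ < _ := by gcongr

/-- The min-max principle: if the Rayleigh quotient of a compact positive operator is at least `c`
on a `k`-dimensional space, then there are at least `k` eigenvalues `≥ c`. -/
theorem le_rank_upperEigenspan [CompleteSpace H] {A : H →L[ℂ] H}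
    (hc : IsCompactOperator A) (hp : A.IsPositive) {c : ℝ} (hc0 : 0 < c) {k : ℕ}
    (Ψ : (Fin k → ℂ) →ₗ[ℂ] H) (hΨ : Function.Injective Ψ)
    (h : ∀ b, c * ‖Ψ b‖ ^ 2 ≤ RCLike.re (inner ℂ (Ψ b) (A (Ψ b)))) :
    (k : Cardinal) ≤ Module.rank ℂ (upperEigenspan A c) := by
  by_contra! hlt
  set S := upperEigenspan A c
  have hfin : FiniteDimensional ℂ S :=
    Module.rank_lt_aleph0_iff.1 (hlt.trans (Cardinal.natCast_lt_aleph0))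
  have hfr : Module.finrank ℂ S < Module.finrank ℂ (Fin k → ℂ) := by
    rw [Module.finrank_fin_fun]
    rw [← Module.finrank_eq_rank] at hlt
    exact_mod_cast hlt
  let P : (Fin k → ℂ) →ₗ[ℂ] S := (S.orthogonalProjectionOnto : H →ₗ[ℂ] S) ∘ₗ Ψ
  have hker : LinearMap.ker P ≠ ⊥ := LinearMap.ker_ne_bot_of_finrank_lt hfr
  obtain ⟨b, hb, hb0⟩ := (Submodule.ne_bot_iff _).1 hker
  have hmem : Ψ b ∈ Sᗮ := by
    rw [← Submodule.orthogonalProjectionOnto_eq_zero_iff]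
    exact hb
  have hne : Ψ b ≠ 0 := fun h0 => hb0 (hΨ (by rw [h0, map_zero]))
  exact absurd (h b) (not_le.2 (inner_lt_of_mem_orthogonal_upperEigenspan hc hp hc0 hmem hne))

end MinMax

section CompactKernel

open BoundedContinuousFunction

variable {Q H : Type*} [TopologicalSpace Q] [CompactSpace Q]
  [NormedAddCommGroup H] [InnerProductSpace ℂ H]

/-- The operator `g ↦ (x ↦ ⟪k x, g⟫)` from a Hilbert space to the continuous functions. -/
def kernelOperator (k : C(Q, H)) : H →L[ℂ] (Q →ᵇ ℂ) :=
  LinearMap.mkContinuous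
    { toFun := fun g => mkOfCompact ⟨fun x => inner ℂ (k x) g, by fun_prop⟩
      map_add' := fun f g => by ext x; simp
      map_smul' := fun c g => by ext x; simp }
    ‖k‖ (fun g => by
      refine (BoundedContinuousFunction.norm_le (by positivity)).2 fun x => ?_
      exact (norm_inner_le_norm _ _).trans (by gcongr; exact k.norm_coe_le_norm x))

theorem isCompactOperator_kernelOperator (k : C(Q, H)) : IsCompactOperator (kernelOperator k) := by
  have hcl := (isCompactOperator_iff_isCompact_closure_image_closedBall
    (kernelOperator k : H →ₗ[ℂ] (Q →ᵇ ℂ)) one_pos).2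
  apply hcl
  refine arzela_ascoli (Metric.closedBall (0 : ℂ) ‖k‖) (isCompact_closedBall _ _) _ ?_ ?_
  · rintro f x ⟨g, hg, rfl⟩
    rw [mem_closedBall_zero_iff] at hg ⊢
    refine (norm_inner_le_norm (𝕜 := ℂ) (k x) g).trans ?_
    calc ‖k x‖ * ‖g‖ ≤ ‖k‖ * 1 := by gcongr; exact k.norm_coe_le_norm x
      _ = ‖k‖ := mul_one _
  · intro x₀
    rw [Metric.equicontinuousAt_iff_right]
    intro ε hε
    filter_upwards [(Metric.continuous_iff'.1 k.continuous) x₀ ε hε] with x hx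
    rintro ⟨f, g, hg, rfl⟩
    rw [mem_closedBall_zero_iff] at hg
    change dist (inner ℂ (k x₀) g) (inner ℂ (k x) g) < ε
    rw [dist_eq_norm, ← inner_sub_left]
    rw [dist_comm, dist_eq_norm] at hx
    calc _ ≤ ‖k x₀ - k x‖ * ‖g‖ := norm_inner_le_norm _ _
      _ ≤ ‖k x₀ - k x‖ * 1 := by gcongr
      _ < ε := by simpa using hx

end CompactKernel

section Edge

open Set Filter Topology

/-- Lebesgue measure on the edge `(0, ℓ)`. -/
abbrev edgeMeasure (ℓ : ℝ) : Measure ℝ := volume.restrict (Ioo (0 : ℝ) ℓ)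

/-- The primitive of `f` on `(0, ℓ)` that vanishes at `0`. -/
def prim (ℓ : ℝ) (f : ℝ → ℂ) (x : ℝ) : ℂ := ∫ t in Iic x, f t ∂edgeMeasure ℓ

/-- The indicator function of `(0, x)` as an element of `L²(0, ℓ)`. -/
def cutoff (ℓ x : ℝ) : EdgeL2 ℓ :=
  indicatorConstLp 2 (measurableSet_Iic (a := x)) (measure_ne_top _ _) 1

theorem inner_cutoff (ℓ x : ℝ) (f : EdgeL2 ℓ) : inner ℂ (cutoff ℓ x) f = prim ℓ f x :=
  L2.inner_indicatorConstLp_one _ _ _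

theorem continuous_cutoff (ℓ : ℝ) : Continuous (cutoff ℓ) := by
  refine continuous_indicatorConstLp_set (by simp) fun x => ?_
  have hle : ∀ y, edgeMeasure ℓ (symmDiff (Iic y) (Iic x)) ≤ ENNReal.ofReal |y - x| := by
    intro y
    refine (Measure.restrict_apply_le _ _).trans ?_
    have hsub : symmDiff (Iic y) (Iic x) ⊆ uIoc x y := by
      intro z hz
      rw [Set.mem_symmDiff] at hz
      rw [mem_uIoc]
      simp only [mem_Iic] at hz
      grind
    refine (measure_mono hsub).trans ?_
    rw [Real.volume_uIoc]
  refine tendsto_of_tendsto_of_tendsto_of_le_of_le tendsto_const_nhds ?_ (fun _ => zero_le) hle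
  have : Tendsto (fun y : ℝ => ENNReal.ofReal |y - x|) (𝓝 x) (𝓝 (ENNReal.ofReal |x - x|)) :=
    ENNReal.tendsto_ofReal (by fun_prop : Continuous fun y : ℝ => |y - x|).continuousAt.tendsto
  simpa using this

theorem continuous_prim (ℓ : ℝ) (f : EdgeL2 ℓ) : Continuous (prim ℓ f) := by
  have : prim ℓ f = fun x => inner ℂ (cutoff ℓ x) f := funext fun x => (inner_cutoff ℓ x f).symm
  rw [this]
  exact (continuous_cutoff ℓ).inner continuous_const

theorem memLp_comp_projIcc (ℓ : ℝ) (hℓ : 0 ≤ ℓ)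
    (u : BoundedContinuousFunction (Icc (0 : ℝ) ℓ) ℂ) :
    MemLp (fun x => u (projIcc 0 ℓ hℓ x)) 2 (edgeMeasure ℓ) :=
  MemLp.of_bound (u.continuous.comp continuous_projIcc).aestronglyMeasurable ‖u‖
    (Eventually.of_forall fun _ => u.norm_coe_le_norm _)

/-- The class in `L²(0, ℓ)` of a continuous function on `[0, ℓ]`. -/
def ofContinuous (ℓ : ℝ) (hℓ : 0 ≤ ℓ) :
    (BoundedContinuousFunction (Icc (0 : ℝ) ℓ) ℂ) →L[ℂ] EdgeL2 ℓ :=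
  LinearMap.mkContinuous
    { toFun := fun u => (memLp_comp_projIcc ℓ hℓ u).toLp _
      map_add' := fun u v => rfl
      map_smul' := fun c u => rfl }
    _ (fun u => Lp.norm_le_of_ae_bound (norm_nonneg u) (by
        filter_upwards [(memLp_comp_projIcc ℓ hℓ u).coeFn_toLp] with x hx
        change ‖((memLp_comp_projIcc ℓ hℓ u).toLp _ : EdgeL2 ℓ) x‖ ≤ _
        rw [hx]
        exact u.norm_coe_le_norm _))

theorem coeFn_ofContinuous (ℓ : ℝ) (hℓ : 0 ≤ ℓ)
    (u : BoundedContinuousFunction (Icc (0 : ℝ) ℓ) ℂ) :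
    ofContinuous ℓ hℓ u =ᵐ[edgeMeasure ℓ] fun x => u (projIcc 0 ℓ hℓ x) :=
  (memLp_comp_projIcc ℓ hℓ u).coeFn_toLp

/-- The Volterra operator `f ↦ (x ↦ ∫₀ˣ f)` on `L²(0, ℓ)`. -/
def volterra (ℓ : ℝ) (hℓ : 0 ≤ ℓ) : EdgeL2 ℓ →L[ℂ] EdgeL2 ℓ :=
  ofContinuous ℓ hℓ ∘L kernelOperator
    (⟨fun x : Icc (0 : ℝ) ℓ => cutoff ℓ x, (continuous_cutoff ℓ).comp continuous_subtype_val⟩ :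
      C(Icc (0 : ℝ) ℓ, EdgeL2 ℓ))

theorem isCompactOperator_volterra (ℓ : ℝ) (hℓ : 0 ≤ ℓ) : IsCompactOperator (volterra ℓ hℓ) :=
  (isCompactOperator_kernelOperator _).clm_comp (ofContinuous ℓ hℓ)

theorem coeFn_volterra (ℓ : ℝ) (hℓ : 0 ≤ ℓ) (f : EdgeL2 ℓ) :
    volterra ℓ hℓ f =ᵐ[edgeMeasure ℓ] prim ℓ f := by
  filter_upwards [coeFn_ofContinuous ℓ hℓ (kernelOperator
    (⟨fun x : Icc (0 : ℝ) ℓ => cutoff ℓ x, (continuous_cutoff ℓ).comp continuous_subtype_val⟩ :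
      C(Icc (0 : ℝ) ℓ, EdgeL2 ℓ)) f), ae_restrict_mem measurableSet_Ioo] with x hx hx'
  refine hx.trans ?_
  rw [projIcc_of_mem hℓ (Ioo_subset_Icc_self hx')]
  exact inner_cutoff ℓ x f

/-- The constant functions on an edge. -/
def edgeConst (ℓ : ℝ) : ℂ →L[ℂ] EdgeL2 ℓ := Lp.constL 2 (edgeMeasure ℓ) ℂ

theorem coeFn_edgeConst (ℓ : ℝ) (c : ℂ) : edgeConst ℓ c =ᵐ[edgeMeasure ℓ] fun _ => c :=
  Lp.coeFn_const ..

/-- The integral of a function over an edge. -/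
def edgeIntegral (ℓ : ℝ) : EdgeL2 ℓ →L[ℂ] ℂ := innerSL ℂ (edgeConst ℓ 1)

theorem inner_edgeConst (ℓ : ℝ) (c : ℂ) (f : EdgeL2 ℓ) :
    inner ℂ (edgeConst ℓ c) f = starRingEnd ℂ c * edgeIntegral ℓ f := by
  have : edgeConst ℓ c = c • edgeConst ℓ 1 := by rw [← map_smul]; simp
  rw [this, inner_smul_left]
  rfl

theorem edgeIntegral_apply (ℓ : ℝ) (f : EdgeL2 ℓ) :
    edgeIntegral ℓ f = ∫ x, f x ∂edgeMeasure ℓ := by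
  change inner ℂ (edgeConst ℓ 1) f = _
  rw [L2.inner_def]
  refine integral_congr_ae ?_
  filter_upwards [coeFn_edgeConst ℓ 1] with x hx
  rw [hx]; simp

theorem prim_zero (ℓ : ℝ) (f : ℝ → ℂ) : prim ℓ f 0 = 0 := by
  rw [prim, Measure.restrict_restrict measurableSet_Iic]
  have : Iic (0 : ℝ) ∩ Ioo 0 ℓ = ∅ := by ext x; simp; intro h1 h2; linarith
  simp [this]

theorem prim_right (ℓ : ℝ) (f : EdgeL2 ℓ) : prim ℓ f ℓ = edgeIntegral ℓ f := by
  rw [prim, edgeIntegral_apply, Measure.restrict_restrict measurableSet_Iic]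
  congr 2
  exact inter_eq_right.2 fun x hx => hx.2.le

theorem integrable_edgeL2 {ℓ : ℝ} (f : EdgeL2 ℓ) : Integrable f (edgeMeasure ℓ) :=
  (Lp.memLp f).integrable (by norm_num)

theorem integral_mul_prim_add (ℓ : ℝ) {f h : ℝ → ℂ} (hf : Integrable f (edgeMeasure ℓ))
    (hh : Integrable h (edgeMeasure ℓ)) :
    (∫ x, f x * prim ℓ h x ∂edgeMeasure ℓ) + ∫ x, h x * prim ℓ f x ∂edgeMeasure ℓ =
      (∫ x, f x ∂edgeMeasure ℓ) * ∫ x, h x ∂edgeMeasure ℓ := by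
  have hmeas : MeasurableSet {p : ℝ × ℝ | p.2 ≤ p.1} :=
    measurableSet_le measurable_snd measurable_fst
  have key : ∀ u v : ℝ → ℂ, ∀ x, u x * prim ℓ v x =
      ∫ t, ({p : ℝ × ℝ | p.2 ≤ p.1}).indicator (fun p => u p.1 * v p.2) (x, t) ∂edgeMeasure ℓ := by
    intro u v x
    rw [prim, ← integral_const_mul, ← integral_indicator measurableSet_Iic]
    rfl
  have hint : ∀ {u v : ℝ → ℂ}, Integrable u (edgeMeasure ℓ) →
      Integrable v (edgeMeasure ℓ) →
      Integrable (({p : ℝ × ℝ | p.2 ≤ p.1}).indicator (fun p => u p.1 * v p.2))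
        ((edgeMeasure ℓ).prod (edgeMeasure ℓ)) :=
    fun hu hv => (hu.mul_prod hv).indicator hmeas
  have hswap : (∫ x, h x * prim ℓ f x ∂edgeMeasure ℓ) =
      ∫ x, f x * (∫ t in Ici x, h t ∂edgeMeasure ℓ) ∂edgeMeasure ℓ := by
    simp only [key h f]
    rw [integral_integral_swap (f := fun x t => ({p : ℝ × ℝ | p.2 ≤ p.1}).indicator
      (fun p => h p.1 * f p.2) (x, t)) (hint hh hf)]
    refine integral_congr_ae (Eventually.of_forall fun x => ?_)
    dsimp only
    rw [← integral_const_mul, ← integral_indicator measurableSet_Ici]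
    refine integral_congr_ae (Eventually.of_forall fun t => ?_)
    by_cases hxt : x ≤ t <;> simp [indicator, hxt, mul_comm]
  have hi1 : Integrable (fun x => f x * prim ℓ h x) (edgeMeasure ℓ) := by
    simp only [key f h]
    exact (hint hf hh).integral_prod_left
  have hi2 : Integrable (fun x => f x * (∫ t in Ici x, h t ∂edgeMeasure ℓ)) (edgeMeasure ℓ) := by
    have := (hint hh hf).integral_prod_right
    refine this.congr (Eventually.of_forall fun x => ?_)
    dsimp only
    rw [← integral_const_mul, ← integral_indicator measurableSet_Ici]
    refine integral_congr_ae (Eventually.of_forall fun t => ?_)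
    by_cases hxt : x ≤ t <;> simp [indicator, hxt, mul_comm]
  rw [hswap, ← integral_add hi1 hi2, ← integral_mul_const]
  refine integral_congr_ae (Eventually.of_forall fun x => ?_)
  dsimp only
  rw [← mul_add]
  congr 1
  rw [prim, integral_Ici_eq_integral_Ioi, ← integral_add_compl (measurableSet_Iic (a := x)) hh,
    compl_Iic]

theorem inner_volterra_add (ℓ : ℝ) (hℓ : 0 ≤ ℓ) (h f : EdgeL2 ℓ) :
    inner ℂ (volterra ℓ hℓ h) f + inner ℂ h (volterra ℓ hℓ f) =
      starRingEnd ℂ (edgeIntegral ℓ h) * edgeIntegral ℓ f := by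
  have hc : Integrable (fun x => starRingEnd ℂ (h x)) (edgeMeasure ℓ) := by
    have := integrable_edgeL2 h
    exact (LinearIsometryEquiv.integrable_comp_iff Complex.conjLIE).2 this
  have hmain := integral_mul_prim_add ℓ (integrable_edgeL2 f) hc
  have hpc : ∀ x, prim ℓ (fun x => starRingEnd ℂ (h x)) x = starRingEnd ℂ (prim ℓ h x) :=
    fun x => integral_conj
  rw [L2.inner_def, L2.inner_def, edgeIntegral_apply, edgeIntegral_apply, ← integral_conj,
    mul_comm (∫ x, starRingEnd ℂ (h x) ∂edgeMeasure ℓ), ← hmain]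
  congr 1
  · refine integral_congr_ae ?_
    filter_upwards [coeFn_volterra ℓ hℓ h] with x hx
    rw [hx, hpc, RCLike.inner_apply]
  · refine integral_congr_ae ?_
    filter_upwards [coeFn_volterra ℓ hℓ f] with x hx
    rw [hx, RCLike.inner_apply, mul_comm]

theorem HasWeakDeriv.congr {ℓ : ℝ} {f f₁ g g₁ : ℝ → ℂ} (h : HasWeakDeriv ℓ f g)
    (hf : f₁ =ᵐ[edgeMeasure ℓ] f) (hg : g₁ =ᵐ[edgeMeasure ℓ] g) : HasWeakDeriv ℓ f₁ g₁ := by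
  intro φ h1 h2 h3
  have e1 : ∫ x in Ioo 0 ℓ, ((deriv φ x : ℝ) : ℂ) * f₁ x =
      ∫ x in Ioo 0 ℓ, ((deriv φ x : ℝ) : ℂ) * f x :=
    integral_congr_ae (by filter_upwards [hf] with x hx; rw [hx])
  have e2 : ∫ x in Ioo 0 ℓ, ((φ x : ℝ) : ℂ) * g₁ x = ∫ x in Ioo 0 ℓ, ((φ x : ℝ) : ℂ) * g x :=
    integral_congr_ae (by filter_upwards [hg] with x hx; rw [hx])
  rw [e1, e2]
  exact h φ h1 h2 h3

theorem hasWeakDeriv_const_add_prim (ℓ : ℝ) (c : ℂ) {f : ℝ → ℂ}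
    (hf : Integrable f (edgeMeasure ℓ)) (hp : Integrable (prim ℓ f) (edgeMeasure ℓ)) :
    HasWeakDeriv ℓ (fun x => c + prim ℓ f x) f := by
  intro φ hφ hφc hφs
  have hφ0 : ∀ x, x ∉ Ioo 0 ℓ → φ x = 0 := fun x hx => image_eq_zero_of_notMem_tsupport
    fun h => hx (hφs h)
  have hd : Continuous (deriv φ) := hφ.continuous_deriv (by simp)
  have hdc : HasCompactSupport (deriv φ) := hφc.deriv
  have hdC : Continuous fun x => ((deriv φ x : ℝ) : ℂ) := Complex.continuous_ofReal.comp hd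
  have hdi : Integrable (fun x => ((deriv φ x : ℝ) : ℂ)) (edgeMeasure ℓ) :=
    (hd.integrable_of_hasCompactSupport hdc).ofReal.restrict
  obtain ⟨M, hM⟩ := hdc.exists_bound_of_continuous hd
  have hprim : ∀ x ∈ Icc 0 ℓ, prim ℓ (fun x => ((deriv φ x : ℝ) : ℂ)) x = (φ x : ℂ) := by
    intro x hx
    rw [prim, Measure.restrict_restrict measurableSet_Iic]
    have hae : (Iic x ∩ Ioo 0 ℓ : Set ℝ) =ᵐ[volume] Ioc 0 x := by
      rw [show Ioc 0 x = Iic x ∩ Ioc 0 ℓ by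
        ext y; simp only [mem_Ioc, mem_inter_iff, mem_Iic]
        constructor
        · rintro ⟨a, b⟩; exact ⟨b, a, b.trans hx.2⟩
        · rintro ⟨a, b, -⟩; exact ⟨b, a⟩]
      exact (ae_eq_refl _).inter Ioo_ae_eq_Ioc
    rw [Measure.restrict_congr_set hae, ← intervalIntegral.integral_of_le hx.1,
      intervalIntegral.integral_ofReal, intervalIntegral.integral_deriv_eq_sub'
        φ rfl (fun y _ => (hφ.differentiable (by simp)).differentiableAt) hd.continuousOn,
      hφ0 0 (by simp), sub_zero]
  have htot : ∫ x, ((deriv φ x : ℝ) : ℂ) ∂edgeMeasure ℓ = 0 := by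
    rcases le_or_gt 0 ℓ with hℓ | hℓ
    · have := hprim ℓ ⟨hℓ, le_rfl⟩
      rw [prim, Measure.restrict_restrict measurableSet_Iic,
        inter_eq_right.2 fun x hx => hx.2.le, hφ0 ℓ (by simp)] at this
      simpa using this
    · simp [edgeMeasure, Ioo_eq_empty hℓ.not_gt]
  have hmain := integral_mul_prim_add ℓ hf hdi
  rw [htot, mul_zero] at hmain
  have e1 : ∫ x, f x * prim ℓ (fun x => ((deriv φ x : ℝ) : ℂ)) x ∂edgeMeasure ℓ =
      ∫ x, (φ x : ℂ) * f x ∂edgeMeasure ℓ := by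
    refine integral_congr_ae ?_
    filter_upwards [ae_restrict_mem measurableSet_Ioo] with x hx
    rw [hprim x (Ioo_subset_Icc_self hx), mul_comm]
  rw [e1] at hmain
  have hi : Integrable (fun x => ((deriv φ x : ℝ) : ℂ) * prim ℓ f x) (edgeMeasure ℓ) :=
    hp.bdd_mul hdC.aestronglyMeasurable (c := M)
      (Eventually.of_forall fun x => by rw [Complex.norm_real]; exact hM x)
  simp only [mul_add]
  rw [integral_add (hdi.mul_const c) hi, integral_mul_const, htot, zero_mul, zero_add]
  exact eq_neg_of_add_eq_zero_right hmain

theorem coeFn_edgeConst_add_volterra (ℓ : ℝ) (hℓ : 0 ≤ ℓ) (c : ℂ) (w : EdgeL2 ℓ) :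
    ⇑(edgeConst ℓ c + volterra ℓ hℓ w) =ᵐ[edgeMeasure ℓ] fun x => c + prim ℓ w x := by
  filter_upwards [Lp.coeFn_add (edgeConst ℓ c) (volterra ℓ hℓ w), coeFn_edgeConst ℓ c,
    coeFn_volterra ℓ hℓ w] with x h1 h2 h3
  rw [h1, Pi.add_apply, h2, h3]

theorem hasWeakDeriv_edgeConst_add_volterra (ℓ : ℝ) (hℓ : 0 ≤ ℓ) (c : ℂ) (w : EdgeL2 ℓ) :
    HasWeakDeriv ℓ ⇑(edgeConst ℓ c + volterra ℓ hℓ w) w :=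
  (hasWeakDeriv_const_add_prim ℓ c (integrable_edgeL2 w)
    ((integrable_edgeL2 (volterra ℓ hℓ w)).congr (coeFn_volterra ℓ hℓ w))).congr
    (coeFn_edgeConst_add_volterra ℓ hℓ c w) (ae_eq_refl _)

theorem hasEndpointValues_edgeConst_add_volterra (ℓ : ℝ) (hℓ : 0 ≤ ℓ) (c : ℂ) (w : EdgeL2 ℓ) :
    HasEndpointValues ℓ ⇑(edgeConst ℓ c + volterra ℓ hℓ w) c (c + edgeIntegral ℓ w) :=
  ⟨fun x => c + prim ℓ w x, (continuous_const.add (continuous_prim ℓ w)).continuousOn,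
    coeFn_edgeConst_add_volterra ℓ hℓ c w, by simp [prim_zero], congrArg (c + ·) (prim_right ℓ w)⟩

end Edge

namespace MetricGraph

section Tree

variable {V E : Type*} {G : MetricGraph V E}

open Classical in
/-- The indicator function of the side of the edge `e` that contains `t e`, that is, of the
vertices that can be reached from `t e` without using `e`. -/
def sideIndicator (G : MetricGraph V E) (e : E) (v : V) : ℝ :=
  if (G.toSimpleGraph.deleteEdges {s(G.o e, G.t e)}).Reachable (G.t e) v then 1 else 0

theorem sideIndicator_eq_zero_or_one (G : MetricGraph V E) (e : E) (v : V) :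
    G.sideIndicator e v = 0 ∨ G.sideIndicator e v = 1 := by
  unfold sideIndicator
  split_ifs <;> simp

theorem IsTree.adj (hG : G.IsTree) (e : E) : G.toSimpleGraph.Adj (G.o e) (G.t e) := by
  rw [toSimpleGraph, SimpleGraph.fromEdgeSet_adj]
  exact ⟨⟨e, rfl⟩, hG.no_loops e⟩

theorem IsTree.sideIndicator_self_sub (hG : G.IsTree) (e : E) :
    G.sideIndicator e (G.t e) - G.sideIndicator e (G.o e) = 1 := by
  have hb := SimpleGraph.isAcyclic_iff_forall_isBridge.1 hG.isTree.isAcyclic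
    (e := s(G.o e, G.t e)) (hG.adj e)
  rw [SimpleGraph.isBridge_iff] at hb
  have h1 : ¬ (G.toSimpleGraph.deleteEdges {s(G.o e, G.t e)}).Reachable (G.t e) (G.o e) :=
    fun h => hb h.symm
  simp [sideIndicator, h1]

theorem IsTree.sideIndicator_eq_of_ne (hG : G.IsTree) {e e' : E} (h : e' ≠ e) :
    G.sideIndicator e (G.t e') = G.sideIndicator e (G.o e') := by
  have hadj : (G.toSimpleGraph.deleteEdges {s(G.o e, G.t e)}).Adj (G.o e') (G.t e') := by
    rw [SimpleGraph.deleteEdges_adj]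
    exact ⟨hG.adj e', fun h' => h (hG.no_parallel_edges h')⟩
  have hiff : (G.toSimpleGraph.deleteEdges {s(G.o e, G.t e)}).Reachable (G.t e) (G.t e') ↔
      (G.toSimpleGraph.deleteEdges {s(G.o e, G.t e)}).Reachable (G.t e) (G.o e') :=
    ⟨fun h => h.trans hadj.reachable.symm, fun h => h.trans hadj.reachable⟩
  classical
  unfold sideIndicator
  congr 1
  exact propext hiff

open Classical in
theorem IsTree.sideIndicator_sub (hG : G.IsTree) (e e' : E) :
    G.sideIndicator e (G.t e') - G.sideIndicator e (G.o e') = if e = e' then 1 else 0 := by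
  split_ifs with h
  · rw [← h, hG.sideIndicator_self_sub]
  · rw [hG.sideIndicator_eq_of_ne (Ne.symm h), sub_self]

/-- A function on the vertices of a tree that takes equal values at the two ends of every edge is
constant. -/
theorem IsTree.eq_of_forall_edge (hG : G.IsTree) {α : Type*} {f : V → α}
    (h : ∀ e, f (G.t e) = f (G.o e)) (v w : V) : f v = f w := by
  obtain ⟨p⟩ := hG.isTree.connected.preconnected v w
  induction p with
  | nil => rfl
  | cons hadj _ ih =>
    rw [← ih]
    rw [toSimpleGraph, SimpleGraph.fromEdgeSet_adj] at hadj
    obtain ⟨⟨e, he⟩, -⟩ := hadj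
    rcases Sym2.eq_iff.1 he with ⟨rfl, rfl⟩ | ⟨rfl, rfl⟩
    · exact (h e).symm
    · exact h e

variable [Fintype E]

open Classical in
/-- The sum of the outward fluxes of the side indicators through a vertex `v`. -/
theorem IsTree.exists_sum_sideIndicator (hG : G.IsTree) (v : V) :
    ∃ d : ℝ, ∀ w, (∑ e with G.t e = v, G.sideIndicator e w) -
      (∑ e with G.o e = v, G.sideIndicator e w) = (if w = v then 1 else 0) + d := by
  let D : V → ℝ := fun w => (∑ e with G.t e = v, G.sideIndicator e w) -
      (∑ e with G.o e = v, G.sideIndicator e w) - (if w = v then 1 else 0)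
  refine ⟨D v, fun w => ?_⟩
  have hD : D w = D v := by
    refine hG.eq_of_forall_edge (fun e' => ?_) w v
    rw [← sub_eq_zero]
    have h1 : ∀ s : Finset E, (∑ e ∈ s, G.sideIndicator e (G.t e')) -
        (∑ e ∈ s, G.sideIndicator e (G.o e')) = if e' ∈ s then 1 else 0 := by
      intro s
      rw [← Finset.sum_sub_distrib, Finset.sum_congr rfl fun e _ => hG.sideIndicator_sub e e',
        Finset.sum_ite_eq']
    have h2 := h1 (Finset.univ.filter fun e => G.t e = v)
    have h3 := h1 (Finset.univ.filter fun e => G.o e = v)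
    simp only [Finset.mem_filter, Finset.mem_univ, true_and] at h2 h3
    simp only [D]
    linarith
  rw [← hD]
  simp only [D]
  ring

end Tree

end MetricGraph

theorem isCompactOperator_pi {ι M : Type*} [Finite ι] [Zero M] [TopologicalSpace M] {N : ι → Type*}
    [∀ i, TopologicalSpace (N i)] {f : M → ∀ i, N i}
    (h : ∀ i, IsCompactOperator fun x => f x i) : IsCompactOperator f := by
  choose K hK hf using h
  refine ⟨Set.univ.pi K, isCompact_univ_pi hK, ?_⟩
  have : f ⁻¹' Set.univ.pi K = ⋂ i, (fun x => f x i) ⁻¹' K i := by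
    ext x; simp
  rw [this]
  exact Filter.iInter_mem.2 hf

namespace MetricGraph

variable {V E : Type*} (G : MetricGraph V E)

/-- The constant function `1` on the graph. -/
def one : G.L2 := WithLp.toLp 2 fun e => edgeConst (G.len e) 1

theorem one_apply (e : E) : G.one e = edgeConst (G.len e) 1 := rfl

variable [Fintype E]

/-- The value at the vertex `v` of the primitive of `g`, where every edge contributes its integral
on the side of its terminal vertex. -/
def vertexValue (v : V) : G.L2 →L[ℂ] ℂ :=
  ∑ e, (G.sideIndicator e v : ℂ) • (edgeIntegral (G.len e) ∘L PiLp.proj 2 _ e)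

theorem vertexValue_apply (v : V) (g : G.L2) :
    G.vertexValue v g = ∑ e, (G.sideIndicator e v : ℂ) * edgeIntegral (G.len e) (g e) := by
  simp [vertexValue]

/-- A primitive of `g` on the tree. -/
def primitive : G.L2 →L[ℂ] G.L2 :=
  ((PiLp.continuousLinearEquiv 2 ℂ fun e => EdgeL2 (G.len e)).symm :
      (∀ e, EdgeL2 (G.len e)) →L[ℂ] G.L2) ∘L
    ContinuousLinearMap.pi fun e =>
      edgeConst (G.len e) ∘L G.vertexValue (G.o e) +
        volterra (G.len e) (G.len_pos e).le ∘L PiLp.proj 2 _ e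

theorem primitive_apply (g : G.L2) (e : E) :
    G.primitive g e = edgeConst (G.len e) (G.vertexValue (G.o e) g) +
      volterra (G.len e) (G.len_pos e).le (g e) := rfl

theorem isCompactOperator_primitive : IsCompactOperator G.primitive := by
  have h : IsCompactOperator fun (g : G.L2) (e : E) =>
      edgeConst (G.len e) (G.vertexValue (G.o e) g) +
        volterra (G.len e) (G.len_pos e).le (g e) := isCompactOperator_pi fun e => ?_
  · exact h.continuous_comp (PiLp.continuous_toLp 2 fun e => EdgeL2 (G.len e))
  refine IsCompactOperator.add ?_ ?_
  · have h1 : IsCompactOperator (edgeConst (G.len e)) :=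
      isCompactOperator_of_locallyCompactSpace_rng _
    exact h1.comp_clm (G.vertexValue (G.o e))
  · exact (isCompactOperator_volterra (G.len e) (G.len_pos e).le).comp_clm
      (PiLp.proj 2 (fun e => EdgeL2 (G.len e)) e : G.L2 →L[ℂ] EdgeL2 (G.len e))

theorem inner_one (f : G.L2) : inner ℂ G.one f = ∑ e, edgeIntegral (G.len e) (f e) := by
  rw [PiLp.inner_apply]
  refine Finset.sum_congr rfl fun e _ => ?_
  rw [one_apply, inner_edgeConst, map_one, one_mul]

theorem edgeIntegral_edgeConst_one {ℓ : ℝ} (hℓ : 0 ≤ ℓ) : edgeIntegral ℓ (edgeConst ℓ 1) = ℓ := by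
  rw [edgeIntegral_apply, integral_congr_ae (coeFn_edgeConst ℓ 1)]
  simp [hℓ]

theorem one_ne_zero [Nonempty E] : G.one ≠ 0 := by
  intro h
  have h1 := G.inner_one G.one
  rw [h, inner_zero_left, ← h] at h1
  simp only [one_apply, edgeIntegral_edgeConst_one (G.len_pos _).le] at h1
  have h2 : 0 < ∑ e, G.len e := Finset.sum_pos (fun e _ => G.len_pos e) Finset.univ_nonempty
  have h3 : ((∑ e, G.len e : ℝ) : ℂ) = 0 := by rw [h1]; push_cast; rfl
  exact h2.ne' (Complex.ofReal_eq_zero.1 h3)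

/-- The mean value of a function on the graph. -/
def mean : G.L2 →L[ℂ] ℂ := ((‖G.one‖ ^ 2 : ℝ) : ℂ)⁻¹ • innerSL ℂ G.one

theorem inner_one_sub_mean [Nonempty E] (f : G.L2) : inner ℂ G.one (f - G.mean f • G.one) = 0 := by
  have h : ((‖G.one‖ : ℝ) : ℂ) ≠ 0 := by
    simpa using G.one_ne_zero
  rw [inner_sub_right, inner_smul_right, inner_self_eq_norm_sq_to_K]
  simp only [mean, _root_.smul_apply, innerSL_apply_apply, smul_eq_mul]
  push_cast
  rw [RCLike.ofReal_eq_complex_ofReal]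
  field_simp
  ring

/-- The primitive with mean value zero. -/
def meanZeroPrimitive : G.L2 →L[ℂ] G.L2 :=
  (ContinuousLinearMap.id ℂ G.L2 - G.mean.smulRight G.one) ∘L G.primitive

theorem meanZeroPrimitive_apply (g : G.L2) :
    G.meanZeroPrimitive g = G.primitive g - G.mean (G.primitive g) • G.one := rfl

theorem isCompactOperator_meanZeroPrimitive : IsCompactOperator G.meanZeroPrimitive :=
  G.isCompactOperator_primitive.clm_comp
    (ContinuousLinearMap.id ℂ G.L2 - G.mean.smulRight G.one)

theorem inner_one_meanZeroPrimitive [Nonempty E] (g : G.L2) :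
    inner ℂ G.one (G.meanZeroPrimitive g) = 0 :=
  G.inner_one_sub_mean _

theorem meanZeroPrimitive_apply_edge (g : G.L2) (e : E) :
    G.meanZeroPrimitive g e =
      edgeConst (G.len e) (G.vertexValue (G.o e) g - G.mean (G.primitive g)) +
        volterra (G.len e) (G.len_pos e).le (g e) := by
  have h : ∀ c : ℂ, c • edgeConst (G.len e) 1 = edgeConst (G.len e) c := fun c => by
    rw [← map_smul]; simp
  rw [meanZeroPrimitive_apply, PiLp.sub_apply, PiLp.smul_apply, one_apply, primitive_apply, h,
    map_sub]
  abel

variable {G}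

theorem IsTree.vertexValue_t (hG : G.IsTree) (g : G.L2) (e : E) :
    G.vertexValue (G.t e) g = G.vertexValue (G.o e) g + edgeIntegral (G.len e) (g e) := by
  classical
  rw [← sub_eq_iff_eq_add', vertexValue_apply, vertexValue_apply, ← Finset.sum_sub_distrib]
  have : ∀ e', (G.sideIndicator e' (G.t e) : ℂ) * edgeIntegral (G.len e') (g e') -
      (G.sideIndicator e' (G.o e) : ℂ) * edgeIntegral (G.len e') (g e') =
      if e' = e then edgeIntegral (G.len e') (g e') else 0 := by
    intro e'
    rw [← sub_mul, ← Complex.ofReal_sub, hG.sideIndicator_sub]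
    split_ifs <;> simp
  simp [this]

variable (G)

/-- The outward flux at `t e` of the adjoint primitive of `f`. -/
def sideIntegral (f : G.L2) (e : E) : ℂ :=
  ∑ e', (G.sideIndicator e (G.o e') : ℂ) * edgeIntegral (G.len e') (f e')

/-- The adjoint of `primitive`, as a function. -/
def primitiveAdjoint (f : G.L2) : G.L2 := WithLp.toLp 2 fun e =>
  edgeConst (G.len e) (G.sideIntegral f e + edgeIntegral (G.len e) (f e)) -
    volterra (G.len e) (G.len_pos e).le (f e)

theorem inner_edgeConst_right (ℓ : ℝ) (c : ℂ) (f : EdgeL2 ℓ) :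
    inner ℂ f (edgeConst ℓ c) = starRingEnd ℂ (edgeIntegral ℓ f) * c := by
  rw [← inner_conj_symm, inner_edgeConst, map_mul, Complex.conj_conj, mul_comm]

theorem inner_primitive (h f : G.L2) :
    inner ℂ (G.primitive h) f = inner ℂ h (G.primitiveAdjoint f) := by
  have hsum : ∑ e, starRingEnd ℂ (G.vertexValue (G.o e) h) * edgeIntegral (G.len e) (f e) =
      ∑ e, starRingEnd ℂ (edgeIntegral (G.len e) (h e)) * G.sideIntegral f e := by
    simp only [vertexValue_apply, sideIntegral, map_sum, map_mul, Complex.conj_ofReal,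
      Finset.sum_mul, Finset.mul_sum]
    rw [Finset.sum_comm]
    refine Finset.sum_congr rfl fun e _ => Finset.sum_congr rfl fun e' _ => by ring
  have h1 : ∀ e, inner ℂ (G.primitive h e) (f e) =
      starRingEnd ℂ (G.vertexValue (G.o e) h) * edgeIntegral (G.len e) (f e) +
        (starRingEnd ℂ (edgeIntegral (G.len e) (h e)) * edgeIntegral (G.len e) (f e) -
          inner ℂ (h e) (volterra (G.len e) (G.len_pos e).le (f e))) := by
    intro e
    rw [primitive_apply, inner_add_left, inner_edgeConst,
      ← inner_volterra_add (G.len e) (G.len_pos e).le]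
    ring
  have h2 : ∀ e, inner ℂ (h e) (G.primitiveAdjoint f e) =
      starRingEnd ℂ (edgeIntegral (G.len e) (h e)) * G.sideIntegral f e +
        (starRingEnd ℂ (edgeIntegral (G.len e) (h e)) * edgeIntegral (G.len e) (f e) -
          inner ℂ (h e) (volterra (G.len e) (G.len_pos e).le (f e))) := by
    intro e
    change inner ℂ (h e) (edgeConst (G.len e) (G.sideIntegral f e + edgeIntegral (G.len e) (f e)) -
      volterra (G.len e) (G.len_pos e).le (f e)) = _
    rw [inner_sub_right, inner_edgeConst_right]
    ring
  rw [PiLp.inner_apply, PiLp.inner_apply, Finset.sum_congr rfl fun e _ => h1 e,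
    Finset.sum_congr rfl fun e _ => h2 e, Finset.sum_add_distrib, Finset.sum_add_distrib, hsum]

theorem adjoint_meanZeroPrimitive_apply {f : G.L2} (hf : inner ℂ G.one f = 0) :
    ContinuousLinearMap.adjoint G.meanZeroPrimitive f = G.primitiveAdjoint f := by
  refine ext_inner_left ℂ fun h => ?_
  rw [ContinuousLinearMap.adjoint_inner_right, meanZeroPrimitive_apply, inner_sub_left,
    inner_smul_left, hf, mul_zero, sub_zero, inner_primitive]

/-- The positive compact operator whose positive eigenvalues are the reciprocals of the positive
eigenvalues of the standard Laplacian. -/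
def primitiveGram : G.L2 →L[ℂ] G.L2 :=
  ContinuousLinearMap.adjoint G.meanZeroPrimitive ∘L G.meanZeroPrimitive

theorem isCompactOperator_primitiveGram : IsCompactOperator G.primitiveGram :=
  G.isCompactOperator_meanZeroPrimitive.clm_comp
    (ContinuousLinearMap.adjoint G.meanZeroPrimitive)

theorem isPositive_primitiveGram : G.primitiveGram.IsPositive :=
  ContinuousLinearMap.isPositive_adjoint_comp_self _

variable {G}

open Classical in
theorem IsTree.kirchhoff_sideIntegral (hG : G.IsTree) {f : G.L2} (hf : inner ℂ G.one f = 0)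
    (v : V) : (∑ e with G.t e = v, G.sideIntegral f e) -
      ∑ e with G.o e = v, (G.sideIntegral f e + edgeIntegral (G.len e) (f e)) = 0 := by
  obtain ⟨d, hd⟩ := hG.exists_sum_sideIndicator v
  have h1 : ∀ s : Finset E, ∑ e ∈ s, G.sideIntegral f e =
      ∑ e', ((∑ e ∈ s, G.sideIndicator e (G.o e') : ℝ) : ℂ) *
        edgeIntegral (G.len e') (f e') := by
    intro s
    simp only [sideIntegral, Complex.ofReal_sum, Finset.sum_mul]
    rw [Finset.sum_comm]
  rw [Finset.sum_add_distrib, ← sub_sub, h1, h1, ← Finset.sum_sub_distrib]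
  have h2 : ∀ e', ((∑ e with G.t e = v, G.sideIndicator e (G.o e') : ℝ) : ℂ) *
        edgeIntegral (G.len e') (f e') -
      ((∑ e with G.o e = v, G.sideIndicator e (G.o e') : ℝ) : ℂ) *
        edgeIntegral (G.len e') (f e') =
      (if G.o e' = v then edgeIntegral (G.len e') (f e') else 0) +
        (d : ℂ) * edgeIntegral (G.len e') (f e') := by
    intro e'
    rw [← sub_mul, ← Complex.ofReal_sub, hd]
    split_ifs
    · push_cast; ring
    · push_cast; ring
  rw [Finset.sum_congr rfl fun e' _ => h2 e', Finset.sum_add_distrib, ← Finset.mul_sum,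
    ← inner_one, hf, mul_zero, add_zero, Finset.sum_filter, sub_self]

theorem IsTree.standardLaplacian_meanZeroPrimitive [Nonempty E] (hG : G.IsTree) {τ : ℝ}
    (hτ : τ ≠ 0) {g : G.L2} (hg : G.primitiveGram g = (τ : ℂ) • g) :
    G.StandardLaplacian (G.meanZeroPrimitive g) (((τ⁻¹ : ℝ) : ℂ) • G.meanZeroPrimitive g) := by
  set f := G.meanZeroPrimitive g with hf
  have hτ' : (τ : ℂ) ≠ 0 := Complex.ofReal_ne_zero.2 hτ
  have hf1 : inner ℂ G.one f = 0 := G.inner_one_meanZeroPrimitive g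
  have hadj : (τ : ℂ) • g = G.primitiveAdjoint f := by
    rw [← hg, ← G.adjoint_meanZeroPrimitive_apply hf1]
    rfl
  have hge : ∀ e, g e = edgeConst (G.len e)
      ((τ : ℂ)⁻¹ * (G.sideIntegral f e + edgeIntegral (G.len e) (f e))) +
        volterra (G.len e) (G.len_pos e).le ((-(((τ⁻¹ : ℝ) : ℂ) • f) : G.L2) e) := by
    intro e
    have h1 : g e = (τ : ℂ)⁻¹ • G.primitiveAdjoint f e := by
      rw [← hadj, PiLp.smul_apply, smul_smul, inv_mul_cancel₀ hτ', one_smul]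
    rw [h1]
    change (τ : ℂ)⁻¹ • (edgeConst (G.len e) (G.sideIntegral f e + edgeIntegral (G.len e) (f e)) -
      volterra (G.len e) (G.len_pos e).le (f e)) = _
    rw [smul_sub, ← map_smul, ← map_smul, smul_eq_mul, PiLp.neg_apply, PiLp.smul_apply, map_neg,
      Complex.ofReal_inv, sub_eq_add_neg]
  refine ⟨g, fun e => ?_, fun e => ?_,
    ⟨fun v => G.vertexValue v g - G.mean (G.primitive g), fun e => ?_⟩,
    fun e => (τ : ℂ)⁻¹ * (G.sideIntegral f e + edgeIntegral (G.len e) (f e)),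
    fun e => (τ : ℂ)⁻¹ * G.sideIntegral f e, fun e => ?_, fun v => ?_⟩
  · rw [hf, meanZeroPrimitive_apply_edge]
    exact hasWeakDeriv_edgeConst_add_volterra _ _ _ _
  · have := hasWeakDeriv_edgeConst_add_volterra (G.len e) (G.len_pos e).le
      ((τ : ℂ)⁻¹ * (G.sideIntegral f e + edgeIntegral (G.len e) (f e)))
      ((-(((τ⁻¹ : ℝ) : ℂ) • f) : G.L2) e)
    rwa [← hge e] at this
  · have := hasEndpointValues_edgeConst_add_volterra (G.len e) (G.len_pos e).le
      (G.vertexValue (G.o e) g - G.mean (G.primitive g)) (g e)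
    rw [← meanZeroPrimitive_apply_edge, ← hf] at this
    dsimp only
    rw [hG.vertexValue_t g e, add_sub_right_comm]
    exact this
  · have := hasEndpointValues_edgeConst_add_volterra (G.len e) (G.len_pos e).le
      ((τ : ℂ)⁻¹ * (G.sideIntegral f e + edgeIntegral (G.len e) (f e)))
      ((-(((τ⁻¹ : ℝ) : ℂ) • f) : G.L2) e)
    rw [← hge e] at this
    have hb : (τ : ℂ)⁻¹ * (G.sideIntegral f e + edgeIntegral (G.len e) (f e)) +
        edgeIntegral (G.len e) ((-(((τ⁻¹ : ℝ) : ℂ) • f) : G.L2) e) =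
        (τ : ℂ)⁻¹ * G.sideIntegral f e := by
      rw [PiLp.neg_apply, PiLp.smul_apply, map_neg, map_smul, Complex.ofReal_inv, smul_eq_mul]
      ring
    rwa [hb] at this
  · rw [← Finset.mul_sum, ← Finset.mul_sum, ← mul_sub, hG.kirchhoff_sideIntegral hf1, mul_zero]

variable (G) in
theorem standardLaplacian_one : G.StandardLaplacian G.one (((0 : ℝ) : ℂ) • G.one) := by
  have h0 : ∀ e, (0 : EdgeL2 (G.len e)) = edgeConst (G.len e) 0 +
      volterra (G.len e) (G.len_pos e).le 0 := by simp
  have h1 : ∀ e, G.one e = edgeConst (G.len e) 1 + volterra (G.len e) (G.len_pos e).le 0 := by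
    intro e; rw [map_zero, add_zero]; rfl
  refine ⟨0, fun e => ?_, fun e => ?_, ⟨fun _ => 1, fun e => ?_⟩, fun _ => 0, fun _ => 0,
    fun e => ?_, by simp⟩
  · rw [h1]
    exact hasWeakDeriv_edgeConst_add_volterra _ _ _ _
  · have := hasWeakDeriv_edgeConst_add_volterra (G.len e) (G.len_pos e).le 0 0
    rw [← h0] at this
    simpa using this
  · rw [h1]
    simpa using hasEndpointValues_edgeConst_add_volterra (G.len e) (G.len_pos e).le 1 0
  · have := hasEndpointValues_edgeConst_add_volterra (G.len e) (G.len_pos e).le 0 0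
    rw [← h0] at this
    simpa using this

theorem IsTree.meanZeroPrimitive_mem_spectralSpan [Nonempty E] (hG : G.IsTree) {c : ℝ} (hc : 0 < c)
    {g : G.L2} (hg : g ∈ upperEigenspan G.primitiveGram c) :
    G.meanZeroPrimitive g ∈ G.spectralSpan c⁻¹ := by
  unfold upperEigenspan at hg
  induction hg using Submodule.iSup_induction' with
  | mem τ x hx =>
    have hpos : 0 < (τ : ℝ) := hc.trans_le τ.2
    exact Submodule.subset_span ⟨(τ : ℝ)⁻¹, inv_anti₀ hc τ.2,
      hG.standardLaplacian_meanZeroPrimitive hpos.ne' (Module.End.mem_eigenspace_iff.1 hx)⟩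
  | zero => simp
  | add x y _ _ hx hy => rw [map_add]; exact add_mem hx hy

theorem eq_zero_of_mem_upperEigenspan {H : Type*} [NormedAddCommGroup H] [InnerProductSpace ℂ H]
    {A : H →L[ℂ] H} (hA : A.IsSymmetric) {c : ℝ} (hc : 0 < c) {g : H}
    (hg : g ∈ upperEigenspan A c) (h0 : A g = 0) : g = 0 := by
  have key : ∀ x ∈ upperEigenspan A c, inner ℂ x g = 0 := by
    intro x hx
    unfold upperEigenspan at hx
    induction hx using Submodule.iSup_induction' with
    | mem τ x hx =>
      have hAx : A x = ((τ : ℝ) : ℂ) • x := Module.End.mem_eigenspace_iff.1 hx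
      have hs : inner ℂ (A x) g = inner ℂ x (A g) := hA x g
      rw [h0, inner_zero_right, hAx, inner_smul_left, Complex.conj_ofReal] at hs
      exact (mul_eq_zero.1 hs).resolve_left (Complex.ofReal_ne_zero.2 (hc.trans_le τ.2).ne')
    | zero => simp
    | add x y _ _ hx hy => rw [inner_add_left, hx, hy, add_zero]
  exact inner_self_eq_zero.1 (key g hg)

theorem IsTree.rank_upperEigenspan_add_one_le [Nonempty E] (hG : G.IsTree) {c : ℝ} (hc : 0 < c) :
    Module.rank ℂ (upperEigenspan G.primitiveGram c) + 1 ≤ Module.rank ℂ (G.spectralSpan c⁻¹) := by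
  let S := upperEigenspan G.primitiveGram c
  let Φ : (S × ℂ) →ₗ[ℂ] G.L2 :=
    (G.meanZeroPrimitive.toLinearMap ∘ₗ S.subtype).coprod (LinearMap.toSpanSingleton ℂ G.L2 G.one)
  have hΦ : ∀ p, Φ p = G.meanZeroPrimitive p.1 + p.2 • G.one := fun p => by
    simp [Φ]
  have hmem : ∀ p, Φ p ∈ G.spectralSpan c⁻¹ := by
    intro p
    rw [hΦ]
    exact add_mem (hG.meanZeroPrimitive_mem_spectralSpan hc p.1.2) (Submodule.smul_mem _ _
      (Submodule.subset_span ⟨0, (inv_pos.2 hc).le, G.standardLaplacian_one⟩))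
  have hinj : Function.Injective (Φ.codRestrict _ hmem) := by
    rw [← LinearMap.ker_eq_bot, LinearMap.ker_codRestrict, LinearMap.ker_eq_bot']
    rintro ⟨g, α⟩ h
    rw [hΦ] at h
    dsimp only at h
    have h1 : inner ℂ G.one (G.meanZeroPrimitive g + α • G.one) = 0 := by rw [h, inner_zero_right]
    rw [inner_add_right, G.inner_one_meanZeroPrimitive, zero_add, inner_smul_right] at h1
    have hα : α = 0 := (mul_eq_zero.1 h1).resolve_right fun h2 =>
      G.one_ne_zero (inner_self_eq_zero.1 h2)
    rw [hα, zero_smul, add_zero] at h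
    have hg : (g : G.L2) = 0 := by
      refine eq_zero_of_mem_upperEigenspan G.isPositive_primitiveGram.isSymmetric hc g.2 ?_
      change ContinuousLinearMap.adjoint G.meanZeroPrimitive (G.meanZeroPrimitive g) = 0
      rw [h, map_zero]
    exact Prod.ext (Subtype.ext hg) hα
  have hrank := LinearMap.rank_le_of_injective _ hinj
  rw [rank_prod, Module.rank_self] at hrank
  simpa using hrank

/-- The variational bound: `k + 1` eigenvalues of the standard Laplacian are at most `c⁻¹` if
`c ‖g‖² ≤ ‖f‖²` for the derivatives `g` and their mean zero primitives `f` in a `k`-dimensional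
space. -/
theorem IsTree.eigenvalue_succ_le [Nonempty E] (hG : G.IsTree) {c : ℝ} (hc : 0 < c) {k : ℕ}
    (Ψ : (Fin k → ℂ) →ₗ[ℂ] G.L2) (hΨ : Function.Injective Ψ)
    (h : ∀ b, c * ‖Ψ b‖ ^ 2 ≤ ‖G.meanZeroPrimitive (Ψ b)‖ ^ 2) :
    G.eigenvalue (k + 1) ≤ ((c⁻¹ : ℝ) : EReal) := by
  refine iInf₂_le c⁻¹ ?_
  refine le_trans ?_ (hG.rank_upperEigenspan_add_one_le hc)
  push_cast
  gcongr
  refine le_rank_upperEigenspan G.isCompactOperator_primitiveGram G.isPositive_primitiveGram hc Ψ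
    hΨ fun b => ?_
  refine (h b).trans_eq ?_
  change _ = RCLike.re (inner ℂ (Ψ b)
    (ContinuousLinearMap.adjoint G.meanZeroPrimitive (G.meanZeroPrimitive (Ψ b))))
  rw [ContinuousLinearMap.adjoint_inner_right, inner_self_eq_norm_sq]

end MetricGraph

section Trigonometric

open Real

theorem integral_cos_int_mul {ℓ : ℝ} (hℓ : 0 < ℓ) (z : ℤ) :
    ∫ y in (0 : ℝ)..ℓ, cos (z * (π / ℓ) * y) = if z = 0 then ℓ else 0 := by
  split_ifs with hz
  · simp [hz]
  · have hw : (z * (π / ℓ) : ℝ) ≠ 0 :=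
      mul_ne_zero (Int.cast_ne_zero.2 hz) (div_pos pi_pos hℓ).ne'
    rw [intervalIntegral.integral_comp_mul_left _ hw, integral_cos, mul_zero, sin_zero,
      show (z : ℝ) * (π / ℓ) * ℓ = z * π by field_simp, sin_int_mul_pi]
    simp

theorem integral_cos_mul_cos {ℓ : ℝ} (hℓ : 0 < ℓ) (m n : ℕ) :
    ∫ y in (0 : ℝ)..ℓ, cos (m * (π / ℓ) * y) * cos (n * (π / ℓ) * y) =
      if m = n then (if m = 0 then ℓ else ℓ / 2) else 0 := by
  have h : ∀ y, cos (m * (π / ℓ) * y) * cos (n * (π / ℓ) * y) =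
      (1 / 2) * (cos (((m - n : ℤ) : ℝ) * (π / ℓ) * y) + cos (((m + n : ℤ) : ℝ) * (π / ℓ) * y)) := by
    intro y
    push_cast
    rw [show ((m : ℝ) - n) * (π / ℓ) * y = m * (π / ℓ) * y - n * (π / ℓ) * y by ring,
      show ((m : ℝ) + n) * (π / ℓ) * y = m * (π / ℓ) * y + n * (π / ℓ) * y by ring,
      cos_sub, cos_add]
    ring
  simp only [h]
  rw [intervalIntegral.integral_const_mul, intervalIntegral.integral_add
    ((by fun_prop : Continuous _).intervalIntegrable _ _)
    ((by fun_prop : Continuous _).intervalIntegrable _ _),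
    integral_cos_int_mul hℓ, integral_cos_int_mul hℓ]
  split_ifs <;> first | omega | ring

theorem integral_sin_mul_sin {ℓ : ℝ} (hℓ : 0 < ℓ) (m n : ℕ) (hm : m ≠ 0) :
    ∫ y in (0 : ℝ)..ℓ, sin (m * (π / ℓ) * y) * sin (n * (π / ℓ) * y) =
      if m = n then ℓ / 2 else 0 := by
  have h : ∀ y, sin (m * (π / ℓ) * y) * sin (n * (π / ℓ) * y) =
      (1 / 2) * (cos (((m - n : ℤ) : ℝ) * (π / ℓ) * y) - cos (((m + n : ℤ) : ℝ) * (π / ℓ) * y)) := by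
    intro y
    push_cast
    rw [show ((m : ℝ) - n) * (π / ℓ) * y = m * (π / ℓ) * y - n * (π / ℓ) * y by ring,
      show ((m : ℝ) + n) * (π / ℓ) * y = m * (π / ℓ) * y + n * (π / ℓ) * y by ring,
      cos_sub, cos_add]
    ring
  simp only [h]
  rw [intervalIntegral.integral_const_mul, intervalIntegral.integral_sub
    ((by fun_prop : Continuous _).intervalIntegrable _ _)
    ((by fun_prop : Continuous _).intervalIntegrable _ _),
    integral_cos_int_mul hℓ, integral_cos_int_mul hℓ]
  split_ifs <;> first | omega | ring

theorem integral_norm_sq_sum {ι : Type*} [Fintype ι] [DecidableEq ι] {a b : ℝ} {s : ι → ℝ → ℝ}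
    (hs : ∀ i, Continuous (s i)) {n : ι → ℝ}
    (horth : ∀ i j, ∫ y in a..b, s i y * s j y = if i = j then n i else 0) (w : ι → ℂ) :
    ∫ y in a..b, ‖∑ i, w i * (s i y : ℂ)‖ ^ 2 = ∑ i, ‖w i‖ ^ 2 * n i := by
  have h : ∀ y, ‖∑ i, w i * (s i y : ℂ)‖ ^ 2 =
      ∑ i, ∑ j, ((w i).re * (w j).re + (w i).im * (w j).im) * (s i y * s j y) := by
    intro y
    rw [← Complex.normSq_eq_norm_sq, Complex.normSq_apply, Complex.re_sum, Complex.im_sum,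
      Finset.sum_mul_sum, Finset.sum_mul_sum, ← Finset.sum_add_distrib]
    refine Finset.sum_congr rfl fun i _ => ?_
    rw [← Finset.sum_add_distrib]
    refine Finset.sum_congr rfl fun j _ => ?_
    simp
    ring
  simp only [h]
  rw [intervalIntegral.integral_finsetSum
    fun i _ => (by fun_prop : Continuous _).intervalIntegrable _ _]
  refine Finset.sum_congr rfl fun i _ => ?_
  rw [intervalIntegral.integral_finsetSum
    fun j _ => (by fun_prop : Continuous _).intervalIntegrable _ _]
  simp only [intervalIntegral.integral_const_mul, horth]
  rw [Finset.sum_eq_single i (fun j _ hj => by simp [hj.symm]) (by simp), if_pos rfl,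
    ← Complex.normSq_eq_norm_sq, Complex.normSq_apply]

/-- The cosine polynomial with coefficients `b` on an interval of length `ℓ`. -/
def cosSum (ℓ : ℝ) {k : ℕ} (b : Fin k → ℂ) (y : ℝ) : ℂ :=
  ∑ j : Fin k, b j * (cos ((((j : ℕ) + 1 : ℕ) : ℝ) * (π / ℓ) * y) : ℝ)

/-- The derivative of `cosSum`, as a linear function of the coefficients. -/
def cosSumDeriv (ℓ : ℝ) (k : ℕ) : (Fin k → ℂ) →ₗ[ℂ] C(ℝ, ℂ) where
  toFun b := ⟨fun y => ∑ j : Fin k, (-((((j : ℕ) + 1 : ℕ) : ℝ) * (π / ℓ) : ℝ) * b j) *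
    (sin ((((j : ℕ) + 1 : ℕ) : ℝ) * (π / ℓ) * y) : ℝ), by fun_prop⟩
  map_add' b b' := by
    ext y
    simp only [ContinuousMap.coe_mk, ContinuousMap.add_apply, Pi.add_apply,
      ← Finset.sum_add_distrib]
    exact Finset.sum_congr rfl fun j _ => by ring
  map_smul' c b := by
    ext y
    simp only [ContinuousMap.coe_mk, ContinuousMap.smul_apply, Pi.smul_apply, smul_eq_mul,
      Finset.mul_sum, RingHom.id_apply]
    exact Finset.sum_congr rfl fun j _ => by ring

theorem cosSumDeriv_apply (ℓ : ℝ) {k : ℕ} (b : Fin k → ℂ) (y : ℝ) :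
    cosSumDeriv ℓ k b y = ∑ j : Fin k, (-((((j : ℕ) + 1 : ℕ) : ℝ) * (π / ℓ) : ℝ) * b j) *
      (sin ((((j : ℕ) + 1 : ℕ) : ℝ) * (π / ℓ) * y) : ℝ) := rfl

theorem hasDerivAt_cosSum (ℓ : ℝ) {k : ℕ} (b : Fin k → ℂ) (y : ℝ) :
    HasDerivAt (cosSum ℓ b) (cosSumDeriv ℓ k b y) y := by
  rw [cosSumDeriv_apply]
  unfold cosSum
  refine HasDerivAt.fun_sum fun j _ => ?_
  have h1 : HasDerivAt (fun y : ℝ => cos ((((j : ℕ) + 1 : ℕ) : ℝ) * (π / ℓ) * y))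
      (-sin ((((j : ℕ) + 1 : ℕ) : ℝ) * (π / ℓ) * y) * ((((j : ℕ) + 1 : ℕ) : ℝ) * (π / ℓ))) y := by
    have h0 : HasDerivAt (fun y : ℝ => (((j : ℕ) + 1 : ℕ) : ℝ) * (π / ℓ) * y)
        ((((j : ℕ) + 1 : ℕ) : ℝ) * (π / ℓ)) y := by
      simpa using (hasDerivAt_id y).const_mul ((((j : ℕ) + 1 : ℕ) : ℝ) * (π / ℓ))
    exact (hasDerivAt_cos _).comp y h0
  refine (h1.ofReal_comp.const_mul (b j)).congr_deriv ?_
  push_cast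
  ring

theorem integral_norm_sq_cosSumDeriv {ℓ : ℝ} (hℓ : 0 < ℓ) {k : ℕ} (b : Fin k → ℂ) :
    ∫ y in (0 : ℝ)..ℓ, ‖cosSumDeriv ℓ k b y‖ ^ 2 =
      ∑ j : Fin k, ((((j : ℕ) + 1 : ℕ) : ℝ) * (π / ℓ)) ^ 2 * ‖b j‖ ^ 2 * (ℓ / 2) := by
  simp only [cosSumDeriv_apply]
  rw [integral_norm_sq_sum (s := fun (j : Fin k) y => sin ((((j : ℕ) + 1 : ℕ) : ℝ) * (π / ℓ) * y))
    (fun j => by fun_prop) (n := fun _ => ℓ / 2) fun i j => ?_]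
  · refine Finset.sum_congr rfl fun j _ => ?_
    rw [norm_mul, norm_neg, Complex.norm_real, mul_pow, Real.norm_eq_abs, sq_abs]
  · rw [integral_sin_mul_sin hℓ _ _ (by omega)]
    simp [Fin.ext_iff]

theorem le_integral_norm_sq_cosSum_add {ℓ : ℝ} (hℓ : 0 < ℓ) {k : ℕ} (b : Fin k → ℂ) (α : ℂ) :
    ∑ j, ‖b j‖ ^ 2 * (ℓ / 2) ≤ ∫ y in (0 : ℝ)..ℓ, ‖cosSum ℓ b y + α‖ ^ 2 := by
  have h : ∀ y, cosSum ℓ b y + α = ∑ j : Fin (k + 1), (Fin.cons α b : Fin (k + 1) → ℂ) j *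
      (cos (((j : ℕ) : ℝ) * (π / ℓ) * y) : ℝ) := by
    intro y
    rw [Fin.sum_univ_succ, add_comm]
    simp [cosSum]
  simp only [h]
  rw [integral_norm_sq_sum (s := fun (j : Fin (k + 1)) y => cos (((j : ℕ) : ℝ) * (π / ℓ) * y))
    (fun j => by fun_prop) (n := fun j => if j = 0 then ℓ else ℓ / 2) fun i j => ?_]
  · rw [Fin.sum_univ_succ]
    simp only [Fin.cons_zero, Fin.cons_succ, if_true, Fin.succ_ne_zero, if_false]
    have : 0 ≤ ‖α‖ ^ 2 * ℓ := by positivity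
    linarith
  · rw [integral_cos_mul_cos hℓ]
    simp only [Fin.val_inj, Fin.val_eq_zero_iff]

/-- The Rayleigh quotient of a cosine polynomial of degree `k`, up to constants. -/
theorem integral_norm_sq_cosSumDeriv_le {ℓ : ℝ} (hℓ : 0 < ℓ) {k : ℕ} (b : Fin k → ℂ) (α : ℂ) :
    ∫ y in (0 : ℝ)..ℓ, ‖cosSumDeriv ℓ k b y‖ ^ 2 ≤
      ((k : ℝ) ^ 2 * π ^ 2 / ℓ ^ 2) * ∫ y in (0 : ℝ)..ℓ, ‖cosSum ℓ b y + α‖ ^ 2 := by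
  refine le_trans ?_ (mul_le_mul_of_nonneg_left (le_integral_norm_sq_cosSum_add hℓ b α)
    (by positivity))
  rw [integral_norm_sq_cosSumDeriv hℓ, Finset.mul_sum]
  refine Finset.sum_le_sum fun j _ => ?_
  have hj : (((j : ℕ) + 1 : ℕ) : ℝ) ≤ k := by exact_mod_cast j.2
  calc _ ≤ ((k : ℝ) * (π / ℓ)) ^ 2 * ‖b j‖ ^ 2 * (ℓ / 2) := by gcongr
    _ = _ := by ring

end Trigonometric

open Set in
theorem prim_eq_intervalIntegral {ℓ x : ℝ} (hx : x ∈ Icc 0 ℓ) (f : ℝ → ℂ) :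
    prim ℓ f x = ∫ y in (0 : ℝ)..x, f y := by
  rw [prim, Measure.restrict_restrict measurableSet_Iic, intervalIntegral.integral_of_le hx.1]
  refine congrArg (fun μ => ∫ y, f y ∂μ) (Measure.restrict_congr_set ?_)
  rw [show Ioc 0 x = Iic x ∩ Ioc 0 ℓ by
    ext y; simp only [mem_Ioc, mem_inter_iff, mem_Iic]
    constructor
    · rintro ⟨a, b⟩; exact ⟨b, a, b.trans hx.2⟩
    · rintro ⟨a, b, -⟩; exact ⟨b, a⟩]
  exact (ae_eq_refl _).inter Ioo_ae_eq_Ioc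

theorem prim_congr {ℓ : ℝ} {f g : ℝ → ℂ} (h : f =ᵐ[edgeMeasure ℓ] g) (x : ℝ) :
    prim ℓ f x = prim ℓ g x :=
  integral_congr_ae (ae_restrict_of_ae h)

theorem norm_sq_edgeL2 {ℓ : ℝ} (hℓ : 0 ≤ ℓ) {f : EdgeL2 ℓ} {g : ℝ → ℂ}
    (h : f =ᵐ[edgeMeasure ℓ] g) : ‖f‖ ^ 2 = ∫ x in (0 : ℝ)..ℓ, ‖g x‖ ^ 2 := by
  rw [← inner_self_eq_norm_sq (𝕜 := ℂ), L2.inner_def, ← integral_re (L2.integrable_inner f f),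
    intervalIntegral.integral_of_le hℓ, integral_Ioc_eq_integral_Ioo]
  refine integral_congr_ae ?_
  filter_upwards [h] with x hx
  rw [hx, inner_self_eq_norm_sq]

theorem memLp_edge (ℓ : ℝ) {f : ℝ → ℂ} (hf : Continuous f) : MemLp f 2 (edgeMeasure ℓ) := by
  obtain ⟨C, hC⟩ := (isCompact_Icc (a := (0 : ℝ)) (b := ℓ)).exists_bound_of_continuousOn
    hf.continuousOn
  refine MemLp.of_bound hf.aestronglyMeasurable C ?_
  filter_upwards [ae_restrict_mem measurableSet_Ioo] with x hx
  exact hC x (Set.Ioo_subset_Icc_self hx)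

namespace MetricGraph

variable {V E : Type*} (G : MetricGraph V E)

theorem memLp_pullback (F : V → ℝ) (σ : E → ℝ) (q : C(ℝ, ℂ)) (e : E) :
    MemLp (fun x => (σ e : ℂ) * q (F (G.o e) + σ e * x)) 2 (edgeMeasure (G.len e)) :=
  memLp_edge (G.len e) (by fun_prop)

/-- The differential of the pull-back of functions along the map from the graph to `ℝ` which has
the values `F` at the vertices and the slopes `σ` on the edges. -/
def pullback (F : V → ℝ) (σ : E → ℝ) : C(ℝ, ℂ) →ₗ[ℂ] G.L2 where
  toFun q := WithLp.toLp 2 fun e => (G.memLp_pullback F σ q e).toLp _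
  map_add' q q' := by
    ext e : 1
    refine Eq.trans ?_
      (MemLp.toLp_add (G.memLp_pullback F σ q e) (G.memLp_pullback F σ q' e))
    refine MemLp.toLp_congr (G.memLp_pullback F σ (q + q') e) _ (Filter.Eventually.of_forall fun x => ?_)
    simp [mul_add]
  map_smul' c q := by
    ext e : 1
    refine Eq.trans ?_ (MemLp.toLp_const_smul c (G.memLp_pullback F σ q e))
    refine MemLp.toLp_congr (G.memLp_pullback F σ (c • q) e) _ (Filter.Eventually.of_forall fun x => ?_)
    simp only [ContinuousMap.smul_apply, smul_eq_mul, Pi.smul_apply]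
    ring

variable {G} {F : V → ℝ} {σ : E → ℝ}

theorem coeFn_pullback (q : C(ℝ, ℂ)) (e : E) : ⇑(G.pullback F σ q e) =ᵐ[edgeMeasure (G.len e)]
    fun x => (σ e : ℂ) * q (F (G.o e) + σ e * x) :=
  (G.memLp_pullback F σ q e).coeFn_toLp

theorem prim_pullback {p : ℝ → ℂ} {q : C(ℝ, ℂ)} (hp : ∀ y, HasDerivAt p (q y) y) (e : E) {x : ℝ}
    (hx : x ∈ Set.Icc 0 (G.len e)) :
    prim (G.len e) (G.pullback F σ q e) x = p (F (G.o e) + σ e * x) - p (F (G.o e)) := by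
  rw [prim_congr (coeFn_pullback q e), prim_eq_intervalIntegral hx]
  have hd : ∀ y : ℝ, HasDerivAt (fun y : ℝ => p (F (G.o e) + σ e * y))
      ((σ e : ℂ) * q (F (G.o e) + σ e * y)) y := by
    intro y
    have h1 : HasDerivAt (fun y : ℝ => F (G.o e) + σ e * y) (σ e) y := by
      simpa using ((hasDerivAt_id y).const_mul (σ e)).const_add (F (G.o e))
    refine ((hp _).scomp y h1).congr_deriv ?_
    simp
  rw [intervalIntegral.integral_eq_sub_of_hasDerivAt (fun y _ => hd y)
    ((by fun_prop : Continuous _).intervalIntegrable _ _)]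
  simp

variable [Fintype E]

theorem IsTree.exists_meanZeroPrimitive_pullback (hG : G.IsTree)
    (hF : ∀ e, F (G.t e) = F (G.o e) + σ e * G.len e) {p : ℝ → ℂ} {q : C(ℝ, ℂ)}
    (hp : ∀ y, HasDerivAt p (q y) y) :
    ∃ α : ℂ, ∀ e, ⇑(G.meanZeroPrimitive (G.pullback F σ q) e) =ᵐ[edgeMeasure (G.len e)]
      fun x => p (F (G.o e) + σ e * x) + α := by
  rcases isEmpty_or_nonempty E with hE | ⟨⟨e₀⟩⟩
  · exact ⟨0, fun e => isEmptyElim e⟩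
  set g := G.pullback F σ q with hg
  have hconst : ∀ v w, G.vertexValue v g - p (F v) = G.vertexValue w g - p (F w) := by
    refine hG.eq_of_forall_edge (f := fun v => G.vertexValue v g - p (F v)) fun e => ?_
    rw [hG.vertexValue_t, ← prim_right, prim_pullback hp e ⟨(G.len_pos e).le, le_rfl⟩, hF]
    ring
  refine ⟨G.vertexValue (G.o e₀) g - p (F (G.o e₀)) - G.mean (G.primitive g), fun e => ?_⟩
  rw [meanZeroPrimitive_apply_edge]
  filter_upwards [coeFn_edgeConst_add_volterra (G.len e) (G.len_pos e).le
    (G.vertexValue (G.o e) g - G.mean (G.primitive g)) (g e),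
    ae_restrict_mem measurableSet_Ioo] with x hx hx'
  rw [hx, prim_pullback hp e (Set.Ioo_subset_Icc_self hx'), hconst (G.o e₀) (G.o e)]
  ring

theorem norm_sq_pullback (q : C(ℝ, ℂ)) : ‖G.pullback F σ q‖ ^ 2 =
    ∑ e, σ e ^ 2 * ∫ x in (0 : ℝ)..G.len e, ‖q (F (G.o e) + σ e * x)‖ ^ 2 := by
  rw [PiLp.norm_sq_eq_of_L2]
  refine Finset.sum_congr rfl fun e _ => ?_
  rw [norm_sq_edgeL2 (G.len_pos e).le (coeFn_pullback q e),
    ← intervalIntegral.integral_const_mul]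
  congr 1 with x
  rw [norm_mul, mul_pow, Complex.norm_real, Real.norm_eq_abs, sq_abs]

/-- If the graph is mapped to `ℝ` with slopes `σ e ∈ [-1, 1]` such that the edges with nonzero slope
tile the interval `[0, ℓ]`, then the eigenvalues are bounded by the Neumann eigenvalues of this
interval. -/
theorem IsTree.eigenvalue_succ_le_of_tiling [Nonempty E] (hG : G.IsTree)
    (hF : ∀ e, F (G.t e) = F (G.o e) + σ e * G.len e) (hσ : ∀ e, σ e ^ 2 ≤ 1) {ℓ : ℝ} (hℓ : 0 < ℓ)
    (htile : ∀ u : ℝ → ℝ, Continuous u →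
      ∑ e, σ e ^ 2 * ∫ x in (0 : ℝ)..G.len e, u (F (G.o e) + σ e * x) = ∫ y in (0 : ℝ)..ℓ, u y)
    {k : ℕ} (hk : 1 ≤ k) :
    G.eigenvalue (k + 1) ≤ (((k : ℝ) ^ 2 * Real.pi ^ 2 / ℓ ^ 2 : ℝ) : EReal) := by
  have hk' : (0 : ℝ) < k := by exact_mod_cast hk
  have hpos : 0 < (k : ℝ) ^ 2 * Real.pi ^ 2 / ℓ ^ 2 := by positivity
  have hnorm : ∀ b : Fin k → ℂ, ‖(G.pullback F σ ∘ₗ cosSumDeriv ℓ k) b‖ ^ 2 =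
      ∑ j : Fin k, ((((j : ℕ) + 1 : ℕ) : ℝ) * (Real.pi / ℓ)) ^ 2 * ‖b j‖ ^ 2 * (ℓ / 2) := by
    intro b
    rw [← integral_norm_sq_cosSumDeriv hℓ, ← htile _ (by fun_prop), ← norm_sq_pullback]
    rfl
  have hmain := hG.eigenvalue_succ_le (inv_pos.2 hpos) (G.pullback F σ ∘ₗ cosSumDeriv ℓ k) ?_ ?_
  · rwa [inv_inv] at hmain
  · rw [← LinearMap.ker_eq_bot, LinearMap.ker_eq_bot']
    intro b hb
    have h0 := hnorm b
    rw [hb, norm_zero, zero_pow two_ne_zero, eq_comm,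
      Finset.sum_eq_zero_iff_of_nonneg fun j _ => by positivity] at h0
    ext j
    have hj := h0 j (Finset.mem_univ j)
    have h1 : 0 < (((j : ℕ) + 1 : ℕ) : ℝ) * (Real.pi / ℓ) := by positivity
    have h2 : ‖b j‖ ^ 2 = 0 := by
      rcases mul_eq_zero.1 hj with h | h
      · exact (mul_eq_zero.1 h).resolve_left (by positivity)
      · exact absurd h (by positivity)
    simpa using h2
  · intro b
    obtain ⟨α, hα⟩ := hG.exists_meanZeroPrimitive_pullback hF (hasDerivAt_cosSum ℓ b)
    have hcont : Continuous (cosSum ℓ b) :=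
      continuous_iff_continuousAt.2 fun y => (hasDerivAt_cosSum ℓ b y).continuousAt
    have h1 : ∫ y in (0 : ℝ)..ℓ, ‖cosSum ℓ b y + α‖ ^ 2 ≤
        ‖G.meanZeroPrimitive (G.pullback F σ (cosSumDeriv ℓ k b))‖ ^ 2 := by
      rw [← htile (fun y => ‖cosSum ℓ b y + α‖ ^ 2) (by fun_prop), PiLp.norm_sq_eq_of_L2]
      refine Finset.sum_le_sum fun e _ => ?_
      rw [norm_sq_edgeL2 (G.len_pos e).le (hα e)]
      exact mul_le_of_le_one_left
        (intervalIntegral.integral_nonneg (G.len_pos e).le fun x _ => by positivity) (hσ e)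
    have h2 : ‖(G.pullback F σ ∘ₗ cosSumDeriv ℓ k) b‖ ^ 2 =
        ∫ y in (0 : ℝ)..ℓ, ‖cosSumDeriv ℓ k b y‖ ^ 2 := by
      rw [hnorm, integral_norm_sq_cosSumDeriv hℓ]
    rw [h2, inv_mul_le_iff₀ hpos]
    exact (integral_norm_sq_cosSumDeriv_le hℓ b α).trans (mul_le_mul_of_nonneg_left h1 hpos.le)

end MetricGraph

namespace MetricGraph

variable {V E : Type*} {G : MetricGraph V E}

theorem IsTree.sideIndicator_o (hG : G.IsTree) (e : E) : G.sideIndicator e (G.o e) = 0 := by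
  have h := hG.sideIndicator_self_sub e
  rcases G.sideIndicator_eq_zero_or_one e (G.o e) with h0 | h0
  · exact h0
  · rcases G.sideIndicator_eq_zero_or_one e (G.t e) with h1 | h1 <;> linarith

variable [Fintype E] [Nonempty E]

theorem IsTree.eigenvalue_succ_le_of_edge (hG : G.IsTree) (e₀ : E) {k : ℕ} (hk : 1 ≤ k) :
    G.eigenvalue (k + 1) ≤ (((k : ℝ) ^ 2 * Real.pi ^ 2 / G.len e₀ ^ 2 : ℝ) : EReal) := by
  classical
  refine hG.eigenvalue_succ_le_of_tiling (F := fun v => G.len e₀ * G.sideIndicator e₀ v)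
    (σ := fun e => if e = e₀ then 1 else 0) (fun e => ?_) (fun e => ?_) (G.len_pos e₀)
    (fun u _ => ?_) hk
  · have h := hG.sideIndicator_sub e₀ e
    rw [sub_eq_iff_eq_add] at h
    simp only [h, eq_comm (a := e) (b := e₀)]
    split_ifs with h'
    · subst h'; ring
    · ring
  · split_ifs <;> norm_num
  · rw [Fintype.sum_eq_single e₀ fun e he => by simp [he]]
    simp [hG.sideIndicator_o]

theorem IsTree.eigenvalue_succ_le_of_aligned (hG : G.IsTree) {e₀ e₁ : E} (hne : e₀ ≠ e₁)
    {k : ℕ} (hk : 1 ≤ k) (ς c : ℝ) (hς : ς ^ 2 = 1)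
    (htile : ∀ u : ℝ → ℝ, Continuous u →
      (∫ x in (0 : ℝ)..G.len e₀, u (ς * G.len e₁ * G.sideIndicator e₁ (G.o e₀) + c + x)) +
        (∫ x in (0 : ℝ)..G.len e₁, u (G.len e₀ * G.sideIndicator e₀ (G.o e₁) + c + ς * x)) =
      ∫ y in (0 : ℝ)..G.len e₀ + G.len e₁, u y) :
    G.eigenvalue (k + 1) ≤
      (((k : ℝ) ^ 2 * Real.pi ^ 2 / (G.len e₀ + G.len e₁) ^ 2 : ℝ) : EReal) := by
  classical
  refine hG.eigenvalue_succ_le_of_tiling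
    (F := fun v => G.len e₀ * G.sideIndicator e₀ v + ς * G.len e₁ * G.sideIndicator e₁ v + c)
    (σ := fun e => if e = e₀ then 1 else if e = e₁ then ς else 0) (fun e => ?_) (fun e => ?_)
    (add_pos (G.len_pos e₀) (G.len_pos e₁)) (fun u hu => ?_) hk
  · have h := hG.sideIndicator_sub e₀ e
    have h' := hG.sideIndicator_sub e₁ e
    rw [sub_eq_iff_eq_add] at h h'
    simp only [h, h', eq_comm (a := e)]
    by_cases h0 : e₀ = e
    · subst h0
      simp only [hne.symm, if_true, if_false]
      ring
    · by_cases h1 : e₁ = e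
      · subst h1
        simp only [h0, if_true, if_false]
        ring
      · simp only [h0, h1, if_false]
        ring
  · split_ifs <;> simp [hς]
  · rw [Fintype.sum_eq_add e₀ e₁ hne fun e he => by simp [he.1, he.2], ← htile u hu]
    simp [hG.sideIndicator_o, hne.symm, hς]

/-- Two edges of a tree can be aligned in an interval, all other edges being contracted. -/
theorem IsTree.eigenvalue_succ_le_of_ne (hG : G.IsTree) {e₀ e₁ : E} (hne : e₀ ≠ e₁)
    {k : ℕ} (hk : 1 ≤ k) :
    G.eigenvalue (k + 1) ≤
      (((k : ℝ) ^ 2 * Real.pi ^ 2 / (G.len e₀ + G.len e₁) ^ 2 : ℝ) : EReal) := by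
  have hint : ∀ {u : ℝ → ℝ}, Continuous u → ∀ a b, IntervalIntegrable u volume a b :=
    fun hu a b => hu.intervalIntegrable a b
  rcases G.sideIndicator_eq_zero_or_one e₁ (G.o e₀) with ha | ha <;>
    rcases G.sideIndicator_eq_zero_or_one e₀ (G.o e₁) with hb | hb
  · refine hG.eigenvalue_succ_le_of_aligned hne hk (-1) (G.len e₁) (by norm_num) fun u hu => ?_
    simp only [ha, hb, mul_zero, zero_add, neg_one_mul, ← sub_eq_add_neg]
    rw [intervalIntegral.integral_comp_add_left, intervalIntegral.integral_comp_sub_left, add_zero,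
      sub_self, sub_zero, add_comm, intervalIntegral.integral_add_adjacent_intervals
      (hint hu _ _) (hint hu _ _), add_comm (G.len e₁)]
  · refine hG.eigenvalue_succ_le_of_aligned hne hk 1 0 (by norm_num) fun u hu => ?_
    simp only [ha, hb, mul_zero, zero_add, one_mul, mul_one, add_zero]
    rw [intervalIntegral.integral_comp_add_left, add_zero,
      intervalIntegral.integral_add_adjacent_intervals (hint hu _ _) (hint hu _ _)]
  · refine hG.eigenvalue_succ_le_of_aligned hne hk 1 0 (by norm_num) fun u hu => ?_
    simp only [ha, hb, mul_zero, zero_add, one_mul, mul_one, add_zero]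
    rw [intervalIntegral.integral_comp_add_left, add_zero, add_comm,
      intervalIntegral.integral_add_adjacent_intervals (hint hu _ _) (hint hu _ _),
      add_comm (G.len e₁)]
  · refine hG.eigenvalue_succ_le_of_aligned hne hk (-1) (G.len e₁) (by norm_num) fun u hu => ?_
    simp only [ha, hb, mul_one, zero_add, neg_one_mul, neg_add_cancel, ← sub_eq_add_neg]
    rw [intervalIntegral.integral_comp_sub_left, sub_zero, add_sub_cancel_right,
      intervalIntegral.integral_add_adjacent_intervals (hint hu _ _) (hint hu _ _)]

end MetricGraph

end

theorem corollary4p2 {V E : Type*} [Fintype V] [Fintype E] [Nonempty E]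
    (G : MetricGraph V E) (hG : G.IsTree) :
    (∀ k : ℕ, 1 ≤ k →
      G.eigenvalue (k + 1) ≤
        (((k : ℝ) ^ 2 * Real.pi ^ 2 / G.maxLength ^ 2 : ℝ) : EReal)) ∧
    ((∃ e₁ e₂ : E, LinearIndependent ℚ ![G.len e₁, G.len e₂]) →
      ∀ k : ℕ, 1 ≤ k →
        G.eigenvalue (k + 1) <
          (((k : ℝ) ^ 2 * Real.pi ^ 2 / G.maxLength ^ 2 : ℝ) : EReal)) := by
  obtain ⟨e₀, -, he₀⟩ := Finset.exists_mem_eq_sup' (Finset.univ_nonempty (α := E)) G.len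
  have hmax : G.maxLength = G.len e₀ := he₀
  rw [hmax]
  refine ⟨fun k hk => hG.eigenvalue_succ_le_of_edge e₀ hk, ?_⟩
  rintro ⟨e₁, e₂, hind⟩ k hk
  have hne : e₁ ≠ e₂ := by
    rintro rfl
    exact absurd (hind.injective (a₁ := 0) (a₂ := 1) rfl) (by decide)
  obtain ⟨e, he⟩ : ∃ e, e₀ ≠ e := by
    by_cases h : e₀ = e₁
    · exact ⟨e₂, h ▸ hne⟩
    · exact ⟨e₁, h⟩
  refine (hG.eigenvalue_succ_le_of_ne he hk).trans_lt (EReal.coe_lt_coe_iff.2 ?_)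
  have hk' : (0 : ℝ) < k := by exact_mod_cast hk
  have h0 := G.len_pos e₀
  have h1 := G.len_pos e
  refine div_lt_div_of_pos_left (by positivity) (by positivity) ?_
  gcongr
  linarith
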